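/- For a natural number $n$, let $Q_n$ be the hypercube: the graph whose vertices are the subsets of $\{1,\dots,n\}$, with $A$ and $B$ adjacent if and only if one of them contains the other and their sizes differ by exactly one. For a graph $H$, let $\mathrm{ex}(Q_n,H)$ be the largest number of edges in a subgraph of $Q_n$ that has no subgraph isomorphic to $H$, and let $C_m$ denote the cycle on $m$ vertices. **Theorem.** For every fixed odd integer $\ell\ge 7$, $$\mathrm{ex}(Q_n,C_{2\ell})=O\left(n^{\frac56+\frac{1}{3(\ell-3)}}\,2^n\right)\qquad(n\to\infty),$$ where the implied constant depends only on $\ell$. Equivalently, for every fixed integer $k\ge 3$, $$\mathrm{ex}(Q_n,C_{4k+2})=O\left(n^{\frac56+\frac{1}{3(2k-2)}}\,2^n\right)\qquad(n\to\infty),$$ where the implied constant depends only on $k$. -/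

import Mathlib

open Filter Asymptotics

/-- The hypercube `Q_n`: its vertices are the subsets of an `n`-element set, and two of them are
adjacent when one is contained in the other and has exactly one element less. -/
def hypercube (n : ℕ) : SimpleGraph (Finset (Fin n)) where
  Adj A B := (A ⊆ B ∧ B.card = A.card + 1) ∨ (B ⊆ A ∧ A.card = B.card + 1)
  symm := ⟨fun _ _ h => h.symm⟩
  loopless := ⟨fun A h => by rcases h with ⟨_, h⟩ | ⟨_, h⟩ <;> omega⟩

/-- The numbers of edges of those subgraphs `G` of `Q_n` that have no subgraph isomorphic
to `H`. -/
def freeEdgeCounts (n : ℕ) {V : Type*} (H : SimpleGraph V) : Set ℕ :=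
  {m | ∃ G : (hypercube n).Subgraph, H.Free G.coe ∧ G.edgeSet.ncard = m}

/-- `ex(Q_n, H)`: the largest number of edges in a subgraph of `Q_n` that has no subgraph
isomorphic to `H`. -/
noncomputable def cubeExtremalNumber (n : ℕ) {V : Type*} (H : SimpleGraph V) : ℕ :=
  sSup (freeEdgeCounts n H)

/-- The supremum is a maximum as soon as `H` has a vertex. -/
theorem cubeExtremalNumber_isGreatest (n : ℕ) {V : Type*} [Nonempty V] (H : SimpleGraph V) :
    IsGreatest (freeEdgeCounts n H) (cubeExtremalNumber n H) := by
  have hfin : (freeEdgeCounts n H).Finite :=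
    (Set.finite_range fun G : (hypercube n).Subgraph => G.edgeSet.ncard).subset
      (by rintro m ⟨G, -, rfl⟩; exact ⟨G, rfl⟩)
  have hne : (freeEdgeCounts n H).Nonempty := by
    refine ⟨_, ⊥, ?_, rfl⟩
    rintro ⟨f⟩
    exact (f.toHom (Classical.arbitrary V)).2
  exact ⟨Nat.sSup_mem hne hfin.bddAbove, fun m hm => le_csSup hfin.bddAbove hm⟩

/-! The bound proved is the stronger `O(n^(5/6) * 2^n)`; the exponents in the theorem only add a
nonnegative term to `5/6`.

Fix a base `x` and regard its full triples as a 3-uniform hypergraph on the `n` coordinates. A strip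
is a cyclic sequence of `l` distinct triples whose consecutive members share distinct pairs. Adding
`x` to these triples and pairs gives a `2l`-cycle of `G` between levels `|x| + 2` and `|x| + 3`
(`IsStrip.cycleGraph_isContained`). With `l = 2k + 3`, the strip is an even wheel of `2k` triples
around a vertex `v`, lengthened by three triples around a rim vertex `b`; this detour makes the
number odd.

A hypergraph without strips has `O(n^(5/2))` triples (`exists_isStrip`). Cauchy–Schwarz over pairs
`(v, b)` produces many pairs `a, a'` in a common neighbourhood. Only `O(n^3)` of these, summed over
all `(v, b)`, have bounded codegree in the link of `v` or of `b`. The remaining ones would contain a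
path of `k` steps, and filling in common neighbours turns it into a strip.

A vertex of down-degree `d` supplies about `d^3` ordered full triples. Summing over all bases, the
average down-degree is `O((n^(5/2))^(1/3)) = O(n^(5/6))`. -/

/-! ### Long paths in dense symmetric relations -/

open Finset in
/-- Iterated pruning of `D`: a vertex survives when it has more than `k` neighbours among the
survivors of the previous round. -/
def prunedVertices {α : Type*} (D : Finset α) (r : α → α → Prop) [DecidableRel r] (k : ℕ) :
    ℕ → Finset α
  | 0 => D
  | j + 1 => {a ∈ D | k < #{b ∈ prunedVertices D r k j | r a b}}

theorem prunedVertices_subset {α : Type*} (D : Finset α) (r : α → α → Prop) [DecidableRel r]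
    (k j : ℕ) : prunedVertices D r k j ⊆ D := by
  cases j with
  | zero => exact subset_rfl
  | succ j => exact Finset.filter_subset _ _

open Finset in
-- Each round loses at most `k * #D` further pairs. If `a` is pruned, at most `k` partners `b`
-- survived the previous round; for any other `b`, the reversed pair `(b, a)` was already lost.
theorem card_pairs_not_mem_prunedVertices_le {α : Type*} [DecidableEq α] (D : Finset α)
    (r : α → α → Prop) [DecidableRel r] (hs : ∀ a b, r a b → r b a) (k j : ℕ) :
    #{p ∈ D ×ˢ D | r p.1 p.2 ∧ p.1 ∉ prunedVertices D r k j} ≤ j * (k * #D) := by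
  induction j with
  | zero =>
    rw [zero_mul, nonpos_iff_eq_zero, card_eq_zero, filter_eq_empty_iff]
    exact fun p hp h => h.2 (mem_product.1 hp).1
  | succ j ih =>
    set A := prunedVertices D r k j with hA
    have hsub : ({p ∈ D ×ˢ D | r p.1 p.2 ∧ p.1 ∉ prunedVertices D r k (j + 1)} : Finset (α × α)) ⊆
        ({p ∈ D ×ˢ D | r p.1 p.2 ∧ p.1 ∉ A} : Finset (α × α)).map (Equiv.prodComm α α).toEmbedding ∪
        {a ∈ D | a ∉ prunedVertices D r k (j + 1)}.biUnion
          fun a => {b ∈ A | r a b}.image fun b => (a, b) := by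
      rintro ⟨a, b⟩ h
      simp only [mem_filter, mem_product] at h
      obtain ⟨⟨ha, hb⟩, hr, hn⟩ := h
      by_cases hbA : b ∈ A
      · exact mem_union_right _ (mem_biUnion.2 ⟨a, mem_filter.2 ⟨ha, hn⟩,
          mem_image.2 ⟨b, mem_filter.2 ⟨hbA, hr⟩, rfl⟩⟩)
      · refine mem_union_left _ (mem_map.2 ⟨(b, a), ?_, rfl⟩)
        simp only [mem_filter, mem_product]
        exact ⟨⟨hb, ha⟩, hs _ _ hr, hbA⟩
    have hcard : #({a ∈ D | a ∉ prunedVertices D r k (j + 1)}.biUnion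
          fun a => {b ∈ A | r a b}.image fun b => (a, b)) ≤ #D * k := by
      refine (card_biUnion_le_card_mul _ _ k fun a ha => ?_).trans
        (Nat.mul_le_mul_right _ (card_filter_le _ _))
      obtain ⟨ha, hn⟩ := mem_filter.1 ha
      refine card_image_le.trans ?_
      by_contra hlt
      exact hn (mem_filter.2 ⟨ha, not_le.1 hlt⟩)
    calc _ ≤ _ := card_le_card hsub
      _ ≤ _ := card_union_le _ _
      _ ≤ j * (k * #D) + #D * k := by rw [card_map]; exact add_le_add ih hcard
      _ = _ := by ring

open Finset in
-- Greedy walk through successively earlier rounds, with `Z` the vertices already used. While a step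
-- remains, `#Z ≤ k`, so one of the more than `k` neighbours is new.
theorem exists_path_of_mem_prunedVertices {α : Type*} [DecidableEq α] (D : Finset α)
    (r : α → α → Prop) [DecidableRel r] (k j : ℕ) :
    ∀ (a : α) (Z : Finset α), a ∈ prunedVertices D r k j → a ∈ Z → #Z + j ≤ k + 1 →
      ∃ p : ℕ → α, p 0 = a ∧ (∀ i ≤ j, p i ∈ D) ∧ (∀ i, 1 ≤ i → i ≤ j → p i ∉ Z) ∧
        Set.InjOn p (Set.Iic j) ∧ ∀ i < j, r (p i) (p (i + 1)) := by
  induction j with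
  | zero =>
    intro a Z ha _ _
    refine ⟨fun _ => a, rfl, fun _ _ => ha, fun i h1 h2 => by omega, ?_, fun i hi => by omega⟩
    intro i hi i' hi' _
    simp only [Set.mem_Iic] at hi hi'
    omega
  | succ j ih =>
    intro a Z ha haZ hZ
    obtain ⟨haD, hdeg⟩ := mem_filter.1 ha
    obtain ⟨b, hb, hbZ⟩ : ∃ b ∈ ({b ∈ prunedVertices D r k j | r a b} : Finset α), b ∉ Z :=
      exists_mem_notMem_of_card_lt_card (by omega)
    obtain ⟨hbA, hab⟩ := mem_filter.1 hb
    obtain ⟨p, hp0, hpD, hpZ, hinj, hadj⟩ := ih b (insert b Z) hbA (mem_insert_self _ _)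
      (by have := card_insert_le b Z; omega)
    have hpZ' : ∀ i ≤ j, p i ∉ Z := by
      intro i hi
      rcases Nat.eq_zero_or_pos i with rfl | h
      · rwa [hp0]
      · exact fun h' => hpZ i h hi (mem_insert_of_mem h')
    refine ⟨fun i => Nat.casesOn i a p, rfl, ?_, ?_, ?_, ?_⟩
    · rintro (_ | i) hi
      · exact haD
      · exact hpD i (by omega)
    · rintro (_ | i) h1 h2
      · omega
      · exact hpZ' i (by omega)
    · rintro (_ | i) hi (_ | i') hi' h
      · rfl
      · exact absurd (show a = p i' from h) fun h => hpZ' i' (by simpa using hi') (h ▸ haZ)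
      · exact absurd (show a = p i from h.symm) fun h => hpZ' i (by simpa using hi) (h ▸ haZ)
      · rw [hinj (by simpa using hi) (by simpa using hi') h]
    · rintro (_ | i) hi
      · simpa [hp0] using hab
      · exact hadj i (by omega)

open Finset in
/-- A symmetric relation with more than `k * k * #D` ordered pairs on `D` contains a path with
`k` steps. -/
theorem exists_path_of_card_lt {α : Type*} [DecidableEq α] (D : Finset α)
    (r : α → α → Prop) [DecidableRel r] (hs : ∀ a b, r a b → r b a) (k : ℕ)
    (h : k * (k * #D) < #{p ∈ D ×ˢ D | r p.1 p.2}) :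
    ∃ p : ℕ → α, (∀ i ≤ k, p i ∈ D) ∧ Set.InjOn p (Set.Iic k) ∧ ∀ i < k, r (p i) (p (i + 1)) := by
  have hne : (prunedVertices D r k k).Nonempty := by
    by_contra hne
    rw [not_nonempty_iff_eq_empty] at hne
    have := card_pairs_not_mem_prunedVertices_le D r hs k k
    simp only [hne, notMem_empty, not_false_eq_true, and_true] at this
    omega
  obtain ⟨a, ha⟩ := hne
  obtain ⟨p, -, h1, -, h2, h3⟩ := exists_path_of_mem_prunedVertices D r k k a {a} ha
    (mem_singleton_self a) (by simp; omega)
  exact ⟨p, h1, h2, h3⟩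

/-! ### Strips in dense triple systems -/

/-- A strip of `m + 3` triples of `R` in which cyclically consecutive triples share a pair: the
vertices `c 0, …, c (m - 1)` form a cycle in the link of `c m`, and a detour through `c (m + 2)`
and `c (m + 1)` replaces one passage at `c 0`. -/
structure IsStrip {α : Type*} (R : α → α → α → Prop) (m : ℕ) (c : ℕ → α) : Prop where
  injOn : Set.InjOn c (Set.Iio (m + 3))
  link : ∀ i, i + 1 < m → R (c m) (c i) (c (i + 1))
  link_last : R (c m) (c (m - 1)) (c 0)
  detour_first : R (c m) (c 0) (c (m + 2))
  detour_second : R (c (m + 1)) (c 0) (c (m + 2))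
  detour_third : R (c (m + 1)) (c 0) (c 1)

open Finset in
-- Hall's condition is immediate: each `S i \ Z` alone has at least `k` elements, and there are only
-- `k` indices.
theorem exists_injective_avoiding {α : Type*} [DecidableEq α] {k : ℕ} (S : Fin k → Finset α)
    (Z : Finset α) (h : ∀ i, k + #Z ≤ #(S i)) :
    ∃ f : Fin k → α, Function.Injective f ∧ ∀ i, f i ∈ S i ∧ f i ∉ Z := by
  obtain ⟨f, hf, hfS⟩ := (all_card_le_biUnion_card_iff_exists_injective fun i => S i \ Z).1 (by
    intro s
    rcases s.eq_empty_or_nonempty with rfl | ⟨i, hi⟩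
    · simp
    · have h1 : #s ≤ k := (card_le_univ s).trans (by simp)
      have h2 := le_card_sdiff Z (S i)
      have h3 := card_le_card (subset_biUnion_of_mem (fun i => S i \ Z) hi)
      have := h i
      omega)
  exact ⟨f, hf, fun i => mem_sdiff.1 (hfS i)⟩

open Finset in
-- Let `g i` be a common neighbour of `p i` and `p (i + 1)`, in the link of `v` for `i ≥ 1` and in
-- the link of `b` for `i = 0`. The rim in the link of `v` is `b, p 1, g 1, p 2, …, g (k - 1), p k`;
-- the detour in the link of `b` is `v, p 0, g 0, p 1`. The threshold `2 * k + 3` pays for `k`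
-- distinct choices avoiding the `k + 3` vertices `v`, `b`, `p 0, …, p k`.
theorem exists_isStrip_of_path {α : Type*} [Fintype α] [DecidableEq α] (R : α → α → α → Prop)
    [∀ a b c, Decidable (R a b c)]
    (h12 : ∀ a b c, R a b c → R b a c) (h23 : ∀ a b c, R a b c → R a c b)
    (hne : ∀ a b c, R a b c → a ≠ b) (k : ℕ) (hk : 2 ≤ k) (v b : α) (p : ℕ → α)
    (hpD : ∀ i ≤ k, R (p i) b v) (hinj : Set.InjOn p (Set.Iic k))
    (hgood : ∀ i < k, 2 * k + 3 ≤ #{y | R (p i) y v ∧ R (p (i + 1)) y v} ∧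
      2 * k + 3 ≤ #{y | R (p i) y b ∧ R (p (i + 1)) y b}) :
    ∃ c, IsStrip R (2 * k) c := by
  set Z : Finset α := insert v (insert b ((range (k + 1)).image p)) with hZ
  have hZc : #Z ≤ k + 3 := by
    have h1 := card_insert_le v (insert b ((range (k + 1)).image p))
    have h2 := card_insert_le b ((range (k + 1)).image p)
    have h3 : #((range (k + 1)).image p) ≤ #(range (k + 1)) := card_image_le
    rw [card_range] at h3
    rw [hZ]
    omega
  obtain ⟨f, hf, hfS⟩ := exists_injective_avoiding
    (fun i : Fin k => if (i : ℕ) = 0 then ({y | R (p i) y b ∧ R (p (i + 1)) y b} : Finset α)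
      else ({y | R (p i) y v ∧ R (p (i + 1)) y v} : Finset α)) Z (by
      intro i
      have := hgood i i.2
      split_ifs <;> omega)
  obtain ⟨g, hg⟩ : ∃ g : ℕ → α, ∀ i : Fin k, g i = f i :=
    ⟨fun i => if h : i < k then f ⟨i, h⟩ else v, fun i => by simp⟩
  have hgZ : ∀ i < k, g i ≠ v ∧ g i ≠ b ∧ ∀ j ≤ k, g i ≠ p j := by
    intro i hi
    have := (hfS ⟨i, hi⟩).2
    rw [← hg ⟨i, hi⟩, hZ] at this
    simp only [mem_insert, mem_image, mem_range, not_or, not_exists, not_and] at this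
    exact ⟨this.1, this.2.1, fun j hj h => this.2.2 j (by omega) h.symm⟩
  have hg0 : R (p 0) (g 0) b ∧ R (p 1) (g 0) b := by
    have := (hfS ⟨0, by omega⟩).1
    rw [← hg ⟨0, by omega⟩] at this
    simpa using this
  have hgi : ∀ i < k, i ≠ 0 → R (p i) (g i) v ∧ R (p (i + 1)) (g i) v := by
    intro i hi h0
    have := (hfS ⟨i, hi⟩).1
    rw [← hg ⟨i, hi⟩] at this
    simpa [h0] using this
  have hginj : ∀ i < k, ∀ j < k, g i = g j → i = j := by
    intro i hi j hj h
    rw [hg ⟨i, hi⟩, hg ⟨j, hj⟩] at h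
    exact Fin.mk.inj_iff.1 (hf h)
  have hpinj : ∀ i ≤ k, ∀ j ≤ k, p i = p j → i = j := fun i hi j hj h => hinj hi hj h
  have hpb : ∀ i ≤ k, p i ≠ b := fun i hi => hne _ _ _ (hpD i hi)
  have hpv : ∀ i ≤ k, p i ≠ v := fun i hi => hne _ _ _ (h23 _ _ _ (hpD i hi))
  have hbv : b ≠ v := hne _ _ _ (h23 _ _ _ (h12 _ _ _ (hpD 0 (by omega))))
  -- The vertex `p 0` is off the rim: it serves only the detour, so it gets the last index.
  obtain ⟨c, hcv, hcw, hca, hcb, hcp, hcg⟩ : ∃ c : ℕ → α, c (2 * k) = v ∧ c (2 * k + 1) = g 0 ∧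
      c (2 * k + 2) = p 0 ∧ c 0 = b ∧ (∀ i < k, c (2 * i + 1) = p (i + 1)) ∧
      ∀ i < k, i ≠ 0 → c (2 * i) = g i := by
    refine ⟨fun j => if j = 2 * k then v else if j = 2 * k + 1 then g 0 else
      if j = 2 * k + 2 then p 0 else if j = 0 then b else if j % 2 = 1 then p (j / 2 + 1) else
      g (j / 2), by simp, by simp, by simp, ?_, ?_, ?_⟩
    · dsimp only; rw [if_neg, if_neg, if_neg, if_pos] <;> omega
    · intro i hi
      dsimp only
      rw [if_neg, if_neg, if_neg, if_neg, if_pos, show (2 * i + 1) / 2 = i by omega] <;> omega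
    · intro i hi h0
      dsimp only
      rw [if_neg, if_neg, if_neg, if_neg, if_neg, show (2 * i) / 2 = i by omega] <;> omega
  have hcases : ∀ j < 2 * k + 3, (j = 2 * k ∧ c j = v) ∨ (j = 0 ∧ c j = b) ∨
      (∃ i ≤ k, c j = p i ∧ (i = 0 ∧ j = 2 * k + 2 ∨ i ≠ 0 ∧ j = 2 * (i - 1) + 1)) ∨
      (∃ i < k, c j = g i ∧ (i = 0 ∧ j = 2 * k + 1 ∨ i ≠ 0 ∧ j = 2 * i)) := by
    intro j hj
    rcases Nat.even_or_odd' j with ⟨i, rfl | rfl⟩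
    · rcases Nat.eq_zero_or_pos i with rfl | h0
      · exact .inr (.inl ⟨rfl, hcb⟩)
      · rcases lt_trichotomy i k with h | rfl | h
        · exact .inr (.inr (.inr ⟨i, h, hcg i h (by omega), .inr ⟨by omega, rfl⟩⟩))
        · exact .inl ⟨rfl, hcv⟩
        · obtain rfl : i = k + 1 := by omega
          exact .inr (.inr (.inl ⟨0, by omega, hca, .inl ⟨rfl, by omega⟩⟩))
    · rcases lt_or_ge i k with h | h
      · exact .inr (.inr (.inl ⟨i + 1, h, hcp i h, .inr ⟨by omega, by omega⟩⟩))
      · obtain rfl : i = k := by omega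
        exact .inr (.inr (.inr ⟨0, by omega, hcw, .inl ⟨rfl, by omega⟩⟩))
  refine ⟨c, ⟨?_, ?_, ?_, ?_, ?_, ?_⟩⟩
  · intro j hj j' hj' h
    rcases hcases j hj with ⟨h1, e⟩ | ⟨h1, e⟩ | ⟨i, hi, e, h1⟩ | ⟨i, hi, e, h1⟩ <;>
    rcases hcases j' hj' with ⟨h2, e'⟩ | ⟨h2, e'⟩ | ⟨i', hi', e', h2⟩ | ⟨i', hi', e', h2⟩ <;>
    rw [e, e'] at h
    · omega
    · exact absurd h.symm hbv
    · exact absurd h.symm (hpv i' hi')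
    · exact absurd h.symm (hgZ i' hi').1
    · exact absurd h hbv
    · omega
    · exact absurd h.symm (hpb i' hi')
    · exact absurd h.symm (hgZ i' hi').2.1
    · exact absurd h (hpv i hi)
    · exact absurd h (hpb i hi)
    · have := hpinj i hi i' hi' h; omega
    · exact absurd h.symm ((hgZ i' hi').2.2 i hi)
    · exact absurd h (hgZ i hi).1
    · exact absurd h (hgZ i hi).2.1
    · exact absurd h ((hgZ i hi).2.2 i' hi')
    · have := hginj i hi i' hi' h; omega
  · intro j hj
    rw [hcv]
    rcases Nat.even_or_odd' j with ⟨i, rfl | rfl⟩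
    · rw [hcp i (by omega)]
      rcases Nat.eq_zero_or_pos i with rfl | h0
      · rw [mul_zero, hcb]
        exact h12 _ _ _ (h23 _ _ _ (h12 _ _ _ (hpD 1 (by omega))))
      · rw [hcg i (by omega) (by omega)]
        exact h12 _ _ _ (h23 _ _ _ (h12 _ _ _ (hgi i (by omega) (by omega)).2))
    · rw [hcp i (by omega), show 2 * i + 1 + 1 = 2 * (i + 1) by ring,
        hcg (i + 1) (by omega) (by omega)]
      exact h12 _ _ _ (h23 _ _ _ (hgi (i + 1) (by omega) (by omega)).1)
  · rw [hcv, hcb, show 2 * k - 1 = 2 * (k - 1) + 1 by omega, hcp _ (by omega),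
      show k - 1 + 1 = k by omega]
    exact h12 _ _ _ (h23 _ _ _ (hpD k le_rfl))
  · rw [hcv, hcb, hca]
    exact h12 _ _ _ (h23 _ _ _ (h12 _ _ _ (hpD 0 (by omega))))
  · rw [hcw, hcb, hca]
    exact h23 _ _ _ (h12 _ _ _ hg0.1)
  · rw [hcw, hcb, show c 1 = p 1 from hcp 0 (by omega)]
    exact h23 _ _ _ (h12 _ _ _ hg0.2)

open Finset in
/-- Pairs of small codegree in the link of `v` lie in few common neighbourhoods. -/
theorem sum_card_pairs_small_codegree_le {α : Type*} [Fintype α] [DecidableEq α]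
    (r : α → α → Prop) [DecidableRel r] (M : ℕ) :
    ∑ b, #{p : α × α | (r p.1 b ∧ r p.2 b) ∧ #{y | r p.1 y ∧ r p.2 y} < M} ≤
      Fintype.card α ^ 2 * M := by
  simp only [card_filter]
  rw [sum_comm]
  simp only [← card_filter]
  calc _ ≤ ∑ _p : α × α, M := by
        refine sum_le_sum fun p _ => ?_
        by_cases h : #{y | r p.1 y ∧ r p.2 y} < M
        · simpa [h] using h.le
        · simp [h]
    _ = _ := by simp [sq]

open Finset in
-- Without a strip, each common neighbourhood `D` of `v` and `b` has at most `k ^ 2 * #D` good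
-- pairs. The other pairs of `D ×ˢ D` are diagonal or have small codegree in one of the two links,
-- and the latter total at most `2 * (2 * k + 3) * n ^ 3`, where `n` is the number of vertices.
theorem exists_isStrip {α : Type*} [Fintype α] [DecidableEq α] (R : α → α → α → Prop)
    [∀ a b c, Decidable (R a b c)]
    (h12 : ∀ a b c, R a b c → R b a c) (h23 : ∀ a b c, R a b c → R a c b)
    (hne : ∀ a b c, R a b c → a ≠ b) (k : ℕ) (hk : 2 ≤ k)
    (hT : Fintype.card α ^ 2 * ((k ^ 2 + 1) * (∑ v, ∑ b, #{a | R a b v}) +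
      2 * (2 * k + 3) * Fintype.card α ^ 3) < (∑ v, ∑ b, #{a | R a b v}) ^ 2) :
    ∃ c, IsStrip R (2 * k) c := by
  by_contra hno
  refine hT.not_ge ?_
  set M := 2 * k + 3 with hM
  set n := Fintype.card α with hn
  let Lv : α → α → ℕ := fun v b =>
    #{p : α × α | (R p.1 b v ∧ R p.2 b v) ∧ #{y | R p.1 y v ∧ R p.2 y v} < M}
  let Lb : α → α → ℕ := fun v b =>
    #{p : α × α | (R p.1 v b ∧ R p.2 v b) ∧ #{y | R p.1 y b ∧ R p.2 y b} < M}
  have hpt : ∀ v b, #{a | R a b v} ^ 2 ≤ (k ^ 2 + 1) * #{a | R a b v} + (Lv v b + Lb v b) := by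
    intro v b
    set D : Finset α := {a | R a b v} with hD
    let good : α → α → Prop := fun a a' => a ≠ a' ∧ M ≤ #{y | R a y v ∧ R a' y v} ∧
      M ≤ #{y | R a y b ∧ R a' y b}
    have hgood : #{p ∈ D ×ˢ D | good p.1 p.2} ≤ k * (k * #D) := by
      by_contra hlt
      obtain ⟨p, hp, hinj, hadj⟩ := exists_path_of_card_lt D good (by
        rintro a a' ⟨h1, h2, h3⟩
        refine ⟨h1.symm, ?_, ?_⟩
        · simpa only [and_comm] using h2
        · simpa only [and_comm] using h3) k (not_le.1 hlt)
      exact hno (exists_isStrip_of_path R h12 h23 hne k hk v b p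
        (fun i hi => by simpa [hD] using hp i hi) hinj fun i hi => (hadj i hi).2)
    have hsub : D ×ˢ D ⊆ ({p ∈ D ×ˢ D | good p.1 p.2} ∪ D.image fun a => (a, a)) ∪
        (({p : α × α | (R p.1 b v ∧ R p.2 b v) ∧ #{y | R p.1 y v ∧ R p.2 y v} < M} :
          Finset (α × α)) ∪
        ({p : α × α | (R p.1 v b ∧ R p.2 v b) ∧ #{y | R p.1 y b ∧ R p.2 y b} < M} :
          Finset (α × α))) := by
      rintro ⟨a, a'⟩ h
      obtain ⟨ha, ha'⟩ := mem_product.1 h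
      have hRa : R a b v := by simpa [hD] using ha
      have hRa' : R a' b v := by simpa [hD] using ha'
      by_cases h1 : a = a'
      · subst h1
        exact mem_union_left _ (mem_union_right _ (mem_image_of_mem _ ha))
      by_cases h2 : #{y | R a y v ∧ R a' y v} < M
      · exact mem_union_right _ (mem_union_left _
          (mem_filter.2 ⟨mem_univ _, ⟨hRa, hRa'⟩, h2⟩))
      by_cases h3 : #{y | R a y b ∧ R a' y b} < M
      · exact mem_union_right _ (mem_union_right _
          (mem_filter.2 ⟨mem_univ _, ⟨h23 _ _ _ hRa, h23 _ _ _ hRa'⟩, h3⟩))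
      exact mem_union_left _ (mem_union_left _
        (mem_filter.2 ⟨h, h1, not_lt.1 h2, not_lt.1 h3⟩))
    have h1 := card_le_card hsub
    rw [card_product] at h1
    have h2 := card_union_le ({p ∈ D ×ˢ D | good p.1 p.2} ∪ D.image fun a => (a, a))
      (({p : α × α | (R p.1 b v ∧ R p.2 b v) ∧ #{y | R p.1 y v ∧ R p.2 y v} < M} :
          Finset (α × α)) ∪
        ({p : α × α | (R p.1 v b ∧ R p.2 v b) ∧ #{y | R p.1 y b ∧ R p.2 y b} < M} :
          Finset (α × α)))
    have h3 := card_union_le ({p ∈ D ×ˢ D | good p.1 p.2}) (D.image fun a => (a, a))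
    have h4 := card_union_le
      ({p : α × α | (R p.1 b v ∧ R p.2 b v) ∧ #{y | R p.1 y v ∧ R p.2 y v} < M} : Finset (α × α))
      ({p : α × α | (R p.1 v b ∧ R p.2 v b) ∧ #{y | R p.1 y b ∧ R p.2 y b} < M} : Finset (α × α))
    have h5 : #(D.image fun a => (a, a)) ≤ #D := card_image_le
    have h6 : (k ^ 2 + 1) * #D = k * (k * #D) + #D := by ring
    have h7 : #D ^ 2 = #D * #D := sq _
    dsimp only [Lv, Lb]
    omega
  have hLv : ∑ v, ∑ b, Lv v b ≤ n * (n ^ 2 * M) := by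
    calc _ ≤ ∑ _v : α, n ^ 2 * M :=
          sum_le_sum fun v _ => sum_card_pairs_small_codegree_le (fun a b => R a b v) M
      _ = _ := by simp [hn]
  have hLb : ∑ v, ∑ b, Lb v b ≤ n * (n ^ 2 * M) := by
    rw [sum_comm]
    calc _ ≤ ∑ _b : α, n ^ 2 * M :=
          sum_le_sum fun b _ => sum_card_pairs_small_codegree_le (fun a v => R a v b) M
      _ = _ := by simp [hn]
  have hCS := sq_sum_le_card_mul_sum_sq (s := (univ : Finset (α × α)))
    (f := fun q => #{a | R a q.2 q.1})
  rw [Fintype.sum_prod_type, Fintype.sum_prod_type, card_univ, Fintype.card_prod, ← hn] at hCS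
  refine hCS.trans ?_
  rw [← sq]
  refine Nat.mul_le_mul_left _ ?_
  calc _ ≤ ∑ v, ∑ b, ((k ^ 2 + 1) * #{a | R a b v} + (Lv v b + Lb v b)) :=
        sum_le_sum fun v _ => sum_le_sum fun b _ => hpt v b
    _ = (k ^ 2 + 1) * (∑ v, ∑ b, #{a | R a b v}) +
        (∑ v, ∑ b, Lv v b + ∑ v, ∑ b, Lb v b) := by
        simp only [sum_add_distrib, mul_sum]
    _ ≤ (k ^ 2 + 1) * (∑ v, ∑ b, #{a | R a b v}) + (n * (n ^ 2 * M) + n * (n ^ 2 * M)) := by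
        gcongr
    _ = _ := by ring

/-! ### From strips to cycles in the cube -/

/-- A closed sequence of `N` distinct vertices, cyclically consecutive ones adjacent, gives a copy
of the cycle graph. -/
theorem cycleGraph_isContained_coe_of_closed_sequence {V : Type*} {H : SimpleGraph V}
    (G : H.Subgraph) {N : ℕ} (F : ℕ → V) (hinj : Set.InjOn F (Set.Iio N)) (hclosed : F N = F 0)
    (hadj : ∀ j < N, G.Adj (F j) (F (j + 1))) :
    (SimpleGraph.cycleGraph N).IsContained G.coe := by
  have key : ∀ u v : Fin N, (u - v).val = 1 → G.Adj (F v) (F u) := by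
    intro u v h
    have hu := u.2
    have hv := v.2
    have : (u : ℕ) = v + 1 ∨ ((v : ℕ) + 1 = N ∧ (u : ℕ) = 0) := by
      rw [Fin.val_sub] at h
      rcases lt_or_ge (N - (v : ℕ) + u) N with h' | h'
      · rw [Nat.mod_eq_of_lt h'] at h
        omega
      · rw [Nat.mod_eq_sub_mod h', Nat.mod_eq_of_lt (by omega)] at h
        omega
    have hvu := hadj v hv
    rcases this with h1 | ⟨h1, h2⟩
    · rwa [h1]
    · rwa [h2, ← hclosed, show F N = F (v + 1) by rw [h1]]
  refine ⟨⟨⟨fun i => ⟨F i, (hadj i i.2).fst_mem⟩, ?_⟩,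
    fun i j h => Fin.ext (hinj i.2 j.2 (Subtype.mk.inj h))⟩⟩
  intro u v h
  rcases SimpleGraph.cycleGraph_adj'.1 h with h | h
  · exact (key u v h).symm
  · exact key v u h

/-- Interleaving the vertices of two sequences. -/
theorem cycleGraph_isContained_coe_of_interleaved {V : Type*} {H : SimpleGraph V}
    (G : H.Subgraph) {l : ℕ} (T P : ℕ → V) (hT : Set.InjOn T (Set.Iio l))
    (hP : Set.InjOn P (Set.Iio l)) (hne : ∀ i < l, ∀ j < l, T i ≠ P j)
    (hclosed : T l = T 0) (h1 : ∀ i < l, G.Adj (T i) (P i))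
    (h2 : ∀ i < l, G.Adj (P i) (T (i + 1))) :
    (SimpleGraph.cycleGraph (2 * l)).IsContained G.coe := by
  obtain ⟨F, hFT, hFP⟩ : ∃ F : ℕ → V, (∀ i, F (2 * i) = T i) ∧ ∀ i, F (2 * i + 1) = P i :=
    ⟨fun j => if j % 2 = 0 then T (j / 2) else P (j / 2), fun i => by simp,
      fun i => by
        dsimp only
        rw [if_neg (by omega), show (2 * i + 1) / 2 = i by omega]⟩
  refine cycleGraph_isContained_coe_of_closed_sequence G F ?_ ?_ ?_
  · intro j hj j' hj' h
    simp only [Set.mem_Iio] at hj hj'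
    rcases Nat.even_or_odd' j with ⟨i, rfl | rfl⟩ <;>
      rcases Nat.even_or_odd' j' with ⟨i', rfl | rfl⟩ <;>
      simp only [hFT, hFP] at h
    · rw [hT (Set.mem_Iio.2 (by omega)) (Set.mem_Iio.2 (by omega)) h]
    · exact absurd h (hne _ (by omega) _ (by omega))
    · exact absurd h.symm (hne _ (by omega) _ (by omega))
    · rw [hP (Set.mem_Iio.2 (by omega)) (Set.mem_Iio.2 (by omega)) h]
  · rw [hFT, hclosed, ← hFT, mul_zero]
  · intro j hj
    rcases Nat.even_or_odd' j with ⟨i, rfl | rfl⟩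
    · rw [hFT, hFP]; exact h1 i (by omega)
    · rw [hFP, show 2 * i + 1 + 1 = 2 * (i + 1) by ring, hFT]; exact h2 i (by omega)

/-- The index triples of a strip, `stripTriple m (m + 3)` repeating the first one. -/
def stripTriple (m i : ℕ) : Finset ℕ :=
  if i + 1 < m then {m, i, i + 1} else if i + 1 = m then {m, m - 1, 0} else
    if i = m then {m, 0, m + 2} else if i = m + 1 then {m + 1, 0, m + 2} else
      if i = m + 2 then {m + 1, 0, 1} else {m, 0, 1}

/-- The index pair shared by the triples `i` and `i + 1` of a strip. -/
def stripPair (m i : ℕ) : Finset ℕ :=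
  if i + 1 < m then {m, i + 1} else if i + 1 = m then {m, 0} else
    if i = m then {0, m + 2} else if i = m + 1 then {m + 1, 0} else {0, 1}

theorem stripTriple_injOn {m : ℕ} (hm : 3 ≤ m) : Set.InjOn (stripTriple m) (Set.Iio (m + 3)) := by
  intro i hi j hj h
  simp only [Set.mem_Iio] at hi hj
  have h0 := fun a => Finset.ext_iff.1 h a
  unfold stripTriple at h0
  split_ifs at h0 <;> simp only [Finset.mem_insert, Finset.mem_singleton] at h0 <;>
    -- Membership of these few indices already separates any two triples.
    have h1 := h0 i <;> have h2 := h0 (i + 1) <;> have h3 := h0 j <;> have h4 := h0 (j + 1) <;>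
    have h5 := h0 m <;> have h6 := h0 (m + 1) <;> have h7 := h0 (m + 2) <;> omega

theorem stripPair_injOn {m : ℕ} (hm : 3 ≤ m) : Set.InjOn (stripPair m) (Set.Iio (m + 3)) := by
  intro i hi j hj h
  simp only [Set.mem_Iio] at hi hj
  have h0 := fun a => Finset.ext_iff.1 h a
  unfold stripPair at h0
  split_ifs at h0 <;> simp only [Finset.mem_insert, Finset.mem_singleton] at h0 <;>
    have h2 := h0 (i + 1) <;> have h4 := h0 (j + 1) <;>
    have h5 := h0 m <;> have h6 := h0 (m + 1) <;> have h7 := h0 (m + 2) <;> omega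

theorem stripPair_subset {m : ℕ} (hm : 3 ≤ m) {i : ℕ} (hi : i < m + 3) :
    stripPair m i ⊆ stripTriple m i ∧ stripPair m i ⊆ stripTriple m (i + 1) := by
  constructor <;> intro a <;> unfold stripPair stripTriple <;> split_ifs <;>
    simp only [Finset.mem_insert, Finset.mem_singleton] <;> omega

theorem card_stripPair {m : ℕ} (hm : 3 ≤ m) {i : ℕ} : (stripPair m i).card = 2 := by
  unfold stripPair
  split_ifs <;> exact Finset.card_pair (by omega)

theorem stripTriple_subset_range {m : ℕ} (hm : 3 ≤ m) (i : ℕ) :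
    stripTriple m i ⊆ Finset.range (m + 3) := by
  intro a
  unfold stripTriple
  split_ifs <;> simp only [Finset.mem_insert, Finset.mem_singleton, Finset.mem_range] <;> omega

/-- The triples above `x` all of whose facets span an edge of `G` with them. -/
def FullTriple {n : ℕ} (G : (hypercube n).Subgraph) (x : Finset (Fin n)) (a b c : Fin n) : Prop :=
  ({a, b, c} : Finset (Fin n)).card = 3 ∧ Disjoint x {a, b, c} ∧
    ∀ e ∈ ({a, b, c} : Finset (Fin n)), G.Adj ((x ∪ {a, b, c}).erase e) (x ∪ {a, b, c})

theorem FullTriple.swap_left {n : ℕ} {G : (hypercube n).Subgraph} {x : Finset (Fin n)}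
    {a b c : Fin n} (h : FullTriple G x a b c) : FullTriple G x b a c := by
  unfold FullTriple
  rwa [Finset.insert_comm]

theorem FullTriple.swap_right {n : ℕ} {G : (hypercube n).Subgraph} {x : Finset (Fin n)}
    {a b c : Fin n} (h : FullTriple G x a b c) : FullTriple G x a c b := by
  unfold FullTriple
  rwa [Finset.pair_comm]

theorem FullTriple.ne {n : ℕ} {G : (hypercube n).Subgraph} {x : Finset (Fin n)}
    {a b c : Fin n} (h : FullTriple G x a b c) : a ≠ b := by
  rintro rfl
  have h1 := h.1
  rw [Finset.insert_eq_of_mem (Finset.mem_insert_self _ _)] at h1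
  have := Finset.card_le_two (a := a) (b := c)
  omega

/-- A strip of full triples above a common base gives a cycle in the hypercube. -/
theorem IsStrip.cycleGraph_isContained {n : ℕ} {G : (hypercube n).Subgraph} {x : Finset (Fin n)}
    {m : ℕ} (hm : 3 ≤ m) {c : ℕ → Fin n} (hc : IsStrip (FullTriple G x) m c) :
    (SimpleGraph.cycleGraph (2 * (m + 3))).IsContained G.coe := by
  have htriple : ∀ i, ((stripTriple m i).image c).card = 3 ∧ Disjoint x ((stripTriple m i).image c) ∧
      ∀ e ∈ (stripTriple m i).image c,
        G.Adj ((x ∪ (stripTriple m i).image c).erase e) (x ∪ (stripTriple m i).image c) := by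
    intro i
    unfold stripTriple
    split_ifs with h1 <;> simp only [Finset.image_insert, Finset.image_singleton]
    · exact hc.link i h1
    · exact hc.link_last
    · exact hc.detour_first
    · exact hc.detour_second
    · exact hc.detour_third
    · exact hc.link 0 (by omega)
  have hinj : ∀ A B : Finset ℕ, A ⊆ Finset.range (m + 3) → B ⊆ Finset.range (m + 3) →
      Disjoint x (A.image c) → Disjoint x (B.image c) → x ∪ A.image c = x ∪ B.image c → A ⊆ B := by
    intro A B hA hB hdA hdB h a ha
    have h1 : c a ∈ x ∪ B.image c := h ▸ Finset.mem_union_right _ (Finset.mem_image_of_mem c ha)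
    rcases Finset.mem_union.1 h1 with h2 | h2
    · exact absurd (Finset.mem_image_of_mem c ha) (Finset.disjoint_left.1 hdA h2)
    · obtain ⟨b, hb, hcb⟩ := Finset.mem_image.1 h2
      rwa [← hc.injOn (Set.mem_Iio.2 (Finset.mem_range.1 (hB hb)))
        (Set.mem_Iio.2 (Finset.mem_range.1 (hA ha))) hcb]
  have hinj' : ∀ A B : Finset ℕ, A ⊆ Finset.range (m + 3) → B ⊆ Finset.range (m + 3) →
      Disjoint x (A.image c) → Disjoint x (B.image c) → x ∪ A.image c = x ∪ B.image c → A = B :=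
    fun A B hA hB hdA hdB h =>
      (hinj A B hA hB hdA hdB h).antisymm (hinj B A hB hA hdB hdA h.symm)
  have hpd : ∀ i < m + 3, Disjoint x ((stripPair m i).image c) := fun i hi =>
    (htriple i).2.1.mono_right (Finset.image_subset_image (stripPair_subset hm hi).1)
  have hpr : ∀ i < m + 3, stripPair m i ⊆ Finset.range (m + 3) := fun i hi =>
    (stripPair_subset hm hi).1.trans (stripTriple_subset_range hm i)
  have hpc : ∀ i < m + 3, ((stripPair m i).image c).card = 2 := by
    intro i hi
    rw [Finset.card_image_of_injOn, card_stripPair hm]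
    exact hc.injOn.mono fun a ha => Set.mem_Iio.2 (Finset.mem_range.1 (hpr i hi ha))
  have hadj : ∀ i j, j < m + 3 → stripPair m j ⊆ stripTriple m i →
      G.Adj (x ∪ (stripPair m j).image c) (x ∪ (stripTriple m i).image c) := by
    intro i j hj hsub
    obtain ⟨h3, hd, he⟩ := htriple i
    have hsub' := Finset.image_subset_image (f := c) hsub
    obtain ⟨e, he1, he2⟩ : ∃ e ∈ (stripTriple m i).image c,
        ((stripTriple m i).image c).erase e = (stripPair m j).image c := by
      have h4 : ((stripTriple m i).image c \ (stripPair m j).image c).card = 1 := by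
        rw [Finset.card_sdiff_of_subset hsub', h3, hpc j hj]
      obtain ⟨e, he⟩ := Finset.card_eq_one.1 h4
      refine ⟨e, (Finset.mem_sdiff.1 (he ▸ Finset.mem_singleton_self e)).1, ?_⟩
      rw [Finset.erase_eq, ← he, Finset.sdiff_sdiff_eq_self hsub']
    have h5 := he e he1
    rwa [Finset.erase_union_distrib, he2,
      Finset.erase_eq_of_notMem (Finset.disjoint_right.1 hd he1)] at h5
  refine cycleGraph_isContained_coe_of_interleaved G (fun i => x ∪ (stripTriple m i).image c)
    (fun i => x ∪ (stripPair m i).image c) ?_ ?_ ?_ ?_ ?_ ?_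
  · intro i hi j hj h
    exact stripTriple_injOn hm hi hj (hinj' _ _ (stripTriple_subset_range hm i)
      (stripTriple_subset_range hm j) (htriple i).2.1 (htriple j).2.1 h)
  · intro i hi j hj h
    exact stripPair_injOn hm hi hj (hinj' _ _ (hpr i hi) (hpr j hj) (hpd i hi) (hpd j hj) h)
  · intro i hi j hj h
    have h1 := congrArg Finset.card h
    rw [Finset.card_union_of_disjoint (htriple i).2.1, Finset.card_union_of_disjoint (hpd j hj),
      (htriple i).1, hpc j hj] at h1
    omega
  · have : stripTriple m (m + 3) = stripTriple m 0 := by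
      unfold stripTriple
      split_ifs <;> first | rfl | omega
    simp only [this]
  · exact fun i hi => (hadj i i hi (stripPair_subset hm hi).1).symm
  · exact fun i hi => hadj (i + 1) i hi (stripPair_subset hm hi).2

/-! ### Down-degrees and full triples -/

open Classical in
/-- The elements whose removal from `y` is an edge of `G`. -/
noncomputable def downSet {n : ℕ} (G : (hypercube n).Subgraph) (y : Finset (Fin n)) :
    Finset (Fin n) :=
  {a ∈ y | G.Adj (y.erase a) y}

open Finset Classical in
theorem ncard_edgeSet_le_sum_card_downSet {n : ℕ} (G : (hypercube n).Subgraph) :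
    G.edgeSet.ncard ≤ ∑ y, #(downSet G y) := by
  rw [← card_sigma]
  have hsub : G.edgeSet ⊆ ((univ.sigma (downSet G)).image fun q => s(q.1.erase q.2, q.1) :
      Finset (Sym2 (Finset (Fin n)))) := by
    have key : ∀ A B, G.Adj A B → A ⊆ B → B.card = A.card + 1 →
        s(A, B) ∈ (univ.sigma (downSet G)).image fun q => s(q.1.erase q.2, q.1) := by
      intro A B hAB hsub hcard
      have h1 : #(B \ A) = 1 := by rw [card_sdiff_of_subset hsub]; omega
      obtain ⟨a, ha⟩ := card_eq_one.1 h1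
      have haB : a ∈ B := (mem_sdiff.1 (ha ▸ mem_singleton_self a)).1
      have hA : B.erase a = A := by rw [erase_eq, ← ha, Finset.sdiff_sdiff_eq_self hsub]
      refine mem_image.2 ⟨⟨B, a⟩, mem_sigma.2 ⟨mem_univ _, mem_filter.2 ⟨haB, ?_⟩⟩, ?_⟩
      · rwa [hA]
      · simp only [hA]
    intro e he
    induction e with
    | _ A B =>
      have hAB : G.Adj A B := SimpleGraph.Subgraph.mem_edgeSet.1 he
      rw [mem_coe]
      rcases G.adj_sub hAB with ⟨h1, h2⟩ | ⟨h1, h2⟩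
      · exact key A B hAB h1 h2
      · rw [Sym2.eq_swap]
        exact key B A hAB.symm h1 h2
  calc _ ≤ _ := Set.ncard_le_ncard hsub (finite_toSet _)
    _ ≤ _ := by rw [Set.ncard_coe_finset]; exact card_image_le

open Finset in
theorem sub_two_pow_three_le_card_triples {α : Type*} [Fintype α] [DecidableEq α] (D : Finset α) :
    (#D - 2) ^ 3 ≤ ∑ v, ∑ b, #{a | (v ∈ D ∧ b ∈ D ∧ a ∈ D) ∧ v ≠ b ∧ a ≠ b ∧ a ≠ v} := by
  calc (#D - 2) ^ 3 ≤ #D * ((#D - 1) * (#D - 2)) := by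
        rw [pow_succ, sq, mul_assoc]
        gcongr <;> omega
    _ = ∑ v ∈ D, ∑ _b ∈ D.erase v, (#D - 2) := by
        rw [sum_congr rfl fun v hv => by rw [sum_const, card_erase_of_mem hv]]
        simp
    _ ≤ ∑ v ∈ D, ∑ b ∈ D.erase v,
          #{a | (v ∈ D ∧ b ∈ D ∧ a ∈ D) ∧ v ≠ b ∧ a ≠ b ∧ a ≠ v} := by
        refine sum_le_sum fun v hv => sum_le_sum fun b hb => ?_
        have h1 : ({a | (v ∈ D ∧ b ∈ D ∧ a ∈ D) ∧ v ≠ b ∧ a ≠ b ∧ a ≠ v} : Finset α) =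
            (D.erase v).erase b := by
          ext a
          have := mem_erase.1 hb
          simp only [mem_filter, mem_univ, true_and, mem_erase]
          constructor
          · tauto
          · rintro ⟨h1, h2, h3⟩
            exact ⟨⟨hv, this.2, h3⟩, this.1.symm, h1, h2⟩
        rw [h1, card_erase_of_mem hb, card_erase_of_mem hv]
        omega
    _ ≤ ∑ v ∈ D, ∑ b, #{a | (v ∈ D ∧ b ∈ D ∧ a ∈ D) ∧ v ≠ b ∧ a ≠ b ∧ a ≠ v} :=
        sum_le_sum fun v _ => sum_le_univ_sum_of_nonneg fun _ => Nat.zero_le _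
    _ ≤ _ := sum_le_univ_sum_of_nonneg fun _ => Nat.zero_le _

open Finset Classical in
/-- Each vertex `y` contributes the ordered triples of its down-neighbourhood to the full triples,
counted by their base `y \ {a, b, v}`. -/
theorem sum_card_triples_downSet_le {n : ℕ} (G : (hypercube n).Subgraph) :
    ∑ y, (#(downSet G y) - 2) ^ 3 ≤ ∑ x, ∑ v, ∑ b, #{a | FullTriple G x a b v} := by
  calc _ ≤ ∑ y, ∑ v, ∑ b, #{a | (v ∈ downSet G y ∧ b ∈ downSet G y ∧ a ∈ downSet G y) ∧
          v ≠ b ∧ a ≠ b ∧ a ≠ v} :=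
        sum_le_sum fun y _ => by convert sub_two_pow_three_le_card_triples (downSet G y)
    _ ≤ _ := ?_
  have key : ∀ (Q : Finset (Fin n) → Fin n → Fin n → Fin n → Prop)
      [∀ x v b a, Decidable (Q x v b a)],
      ∑ x, ∑ v, ∑ b, #{a | Q x v b a} =
        #{q : Finset (Fin n) × Fin n × Fin n × Fin n | Q q.1 q.2.1 q.2.2.1 q.2.2.2} := by
    intro Q _
    simp only [card_filter, Fintype.sum_prod_type]
  rw [key fun y v b a => (v ∈ downSet G y ∧ b ∈ downSet G y ∧ a ∈ downSet G y) ∧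
      v ≠ b ∧ a ≠ b ∧ a ≠ v, key fun x v b a => FullTriple G x a b v]
  have hunion : ∀ (y : Finset (Fin n)) (v b a : Fin n), v ∈ downSet G y → b ∈ downSet G y →
      a ∈ downSet G y → y \ {a, b, v} ∪ {a, b, v} = y := by
    intro y v b a hv hb ha
    refine sdiff_union_of_subset ?_
    simp only [insert_subset_iff, singleton_subset_iff]
    exact ⟨(mem_filter.1 ha).1, (mem_filter.1 hb).1, (mem_filter.1 hv).1⟩
  refine card_le_card_of_injOn (fun q => (q.1 \ {q.2.2.2, q.2.2.1, q.2.1}, q.2)) ?_ ?_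
  · rintro ⟨y, v, b, a⟩ h
    obtain ⟨-, ⟨hv, hb, ha⟩, hvb, hab, hav⟩ := mem_filter.1 (mem_coe.1 h)
    refine mem_coe.2 (mem_filter.2 ⟨mem_univ _, ?_⟩)
    refine ⟨card_eq_three.2 ⟨a, b, v, hab, hav, hvb.symm, rfl⟩, sdiff_disjoint, ?_⟩
    dsimp only
    rw [hunion y v b a hv hb ha]
    intro e he
    simp only [mem_insert, mem_singleton] at he
    rcases he with rfl | rfl | rfl
    · exact (mem_filter.1 ha).2
    · exact (mem_filter.1 hb).2
    · exact (mem_filter.1 hv).2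
  · rintro ⟨y, v, b, a⟩ h ⟨y', v', b', a'⟩ h' heq
    obtain ⟨-, ⟨hv, hb, ha⟩, -⟩ := mem_filter.1 (mem_coe.1 h)
    obtain ⟨-, ⟨hv', hb', ha'⟩, -⟩ := mem_filter.1 (mem_coe.1 h')
    simp only [Prod.mk.injEq] at heq
    obtain ⟨h1, rfl, rfl, rfl⟩ := heq
    rw [← hunion y v b a hv hb ha, h1, hunion y' v b a hv' hb' ha']

/-! ### The edge bound -/

open Finset Classical in
/-- If `G` has no cycle of length `2 * (2 * k + 3)`, every base carries few full triples. -/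
theorem sum_card_fullTriple_le {n : ℕ} (G : (hypercube n).Subgraph) {k : ℕ} (hk : 2 ≤ k)
    (hG : (SimpleGraph.cycleGraph (2 * (2 * k + 3))).Free G.coe) (x : Finset (Fin n)) {t : ℝ}
    (ht : 1 ≤ t) (htn : t ^ 6 = (n : ℝ) ^ 5) :
    ((∑ v, ∑ b, #{a | FullTriple G x a b v} : ℕ) : ℝ) ≤
      ((k ^ 2 + 1) + 2 * (2 * k + 3)) * t ^ 3 := by
  set T := ∑ v, ∑ b, #{a | FullTriple G x a b v} with hT
  have hle : T ^ 2 ≤ n ^ 2 * ((k ^ 2 + 1) * T + 2 * (2 * k + 3) * n ^ 3) := by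
    by_contra hlt
    obtain ⟨c, hc⟩ := exists_isStrip (FullTriple G x) (fun _ _ _ h => h.swap_left)
      (fun _ _ _ h => h.swap_right) (fun _ _ _ h => h.ne) k hk
      (by rw [Fintype.card_fin]; exact not_le.1 hlt)
    exact hG (hc.cycleGraph_isContained (by omega))
  have hleR : (T : ℝ) ^ 2 ≤ n ^ 2 * ((k ^ 2 + 1) * T + 2 * (2 * k + 3) * n ^ 3) := by
    exact_mod_cast hle
  clear_value T
  have hn : (1 : ℝ) ≤ n := by
    rcases Nat.eq_zero_or_pos n with rfl | h
    · have := one_le_pow₀ (n := 6) ht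
      simp at htn
      linarith
    · exact_mod_cast h
  have hn2 : (n : ℝ) ^ 2 ≤ t ^ 3 := by
    refine (sq_le_sq₀ (by positivity) (by positivity)).1 ?_
    calc ((n : ℝ) ^ 2) ^ 2 = (n : ℝ) ^ 4 := by ring
      _ ≤ (n : ℝ) ^ 5 := pow_le_pow_right₀ hn (by norm_num)
      _ = (t ^ 3) ^ 2 := by rw [← htn]; ring
  have hs : 1 ≤ t ^ 3 := one_le_pow₀ ht
  by_contra! hlt
  set A : ℝ := (k : ℝ) ^ 2 + 1 with hA
  set B : ℝ := 2 * (2 * (k : ℝ) + 3) with hB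
  have hA1 : 1 ≤ A := le_add_of_nonneg_left (sq_nonneg _)
  have hB0 : 0 ≤ B := by positivity
  -- If the bound fails, then `T ≥ t ^ 3 = n ^ (5/2)`. Both terms of the quadratic inequality are
  -- then at most a multiple of `t ^ 3 * T`, and cancelling `T` gives a contradiction.
  have hsT : t ^ 3 ≤ T :=
    (le_mul_of_one_le_left (by positivity) (by linarith)).trans hlt.le
  have h1 : (n : ℝ) ^ 2 * (A * T) ≤ t ^ 3 * (A * T) :=
    mul_le_mul_of_nonneg_right hn2 (by positivity)
  have h2 : (n : ℝ) ^ 2 * (B * n ^ 3) ≤ t ^ 3 * (B * T) := by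
    calc _ = B * (n : ℝ) ^ 5 := by ring
      _ = B * (t ^ 3 * t ^ 3) := by rw [← htn]; ring
      _ ≤ B * (t ^ 3 * T) := by gcongr
      _ = _ := by ring
  have h3 : (T : ℝ) * T ≤ (A + B) * t ^ 3 * T := by
    calc (T : ℝ) * T = (T : ℝ) ^ 2 := (sq _).symm
      _ ≤ _ := hleR
      _ = (n : ℝ) ^ 2 * (A * T) + (n : ℝ) ^ 2 * (B * n ^ 3) := by ring
      _ ≤ _ := add_le_add h1 h2
      _ = _ := by ring
  have hT0 : (0 : ℝ) < T := by linarith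
  exact absurd (le_of_mul_le_mul_right h3 hT0) (not_le.2 hlt)

open Finset Classical in
theorem ncard_edgeSet_le {n : ℕ} (hn : 1 ≤ n) (G : (hypercube n).Subgraph) {k : ℕ} (hk : 2 ≤ k)
    (hG : (SimpleGraph.cycleGraph (2 * (2 * k + 3))).Free G.coe) :
    (G.edgeSet.ncard : ℝ) ≤
      ((k ^ 2 + 1) + 2 * (2 * k + 3) + 3) * ((n : ℝ) ^ ((5 : ℝ) / 6) * 2 ^ n) := by
  have hn' : (1 : ℝ) ≤ n := by exact_mod_cast hn
  set t : ℝ := (n : ℝ) ^ ((5 : ℝ) / 6) with ht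
  have ht1 : 1 ≤ t := Real.one_le_rpow hn' (by norm_num)
  have ht6 : t ^ 6 = (n : ℝ) ^ 5 := by
    rw [ht, ← Real.rpow_natCast, ← Real.rpow_mul (by positivity), ← Real.rpow_natCast]
    norm_num
  set C : ℝ := ((k : ℝ) ^ 2 + 1) + 2 * (2 * k + 3) with hC
  -- A linear minorant of the cube replaces the power mean inequality: with `u` the truncated `d -
  -- 2`, it is nonpositive for `u ≤ t`, and `u ^ 3 ≥ t ^ 2 * u` for `u ≥ t`.
  have hpt : ∀ y, t ^ 2 * ((#(downSet G y) : ℝ) - (2 + t)) ≤ ((#(downSet G y) - 2 : ℕ) : ℝ) ^ 3 := by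
    intro y
    set u : ℝ := ((#(downSet G y) - 2 : ℕ) : ℝ) with hu
    have hu0 : 0 ≤ u := Nat.cast_nonneg _
    have hdu : (#(downSet G y) : ℝ) ≤ u + 2 := by
      have : #(downSet G y) ≤ #(downSet G y) - 2 + 2 := by omega
      rw [hu]
      exact_mod_cast this
    rcases le_total u t with h | h
    · have : t ^ 2 * ((#(downSet G y) : ℝ) - (2 + t)) ≤ 0 :=
        mul_nonpos_of_nonneg_of_nonpos (by positivity) (by linarith)
      exact this.trans (by positivity)
    · calc _ ≤ t ^ 2 * u := by gcongr; linarith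
        _ ≤ u ^ 2 * u := by gcongr
        _ = u ^ 3 := by ring
  have hupper : ∑ y, ((#(downSet G y) - 2 : ℕ) : ℝ) ^ 3 ≤ 2 ^ n * (C * t ^ 3) := by
    calc _ ≤ ∑ x, ((∑ v, ∑ b, #{a | FullTriple G x a b v} : ℕ) : ℝ) := by
          exact_mod_cast sum_card_triples_downSet_le G
      _ ≤ ∑ _x : Finset (Fin n), C * t ^ 3 :=
          sum_le_sum fun x _ => sum_card_fullTriple_le G hk hG x ht1 ht6
      _ = _ := by simp
  have hlower : t ^ 2 * (∑ y, (#(downSet G y) : ℝ) - 2 ^ n * (2 + t)) ≤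
      ∑ y, ((#(downSet G y) - 2 : ℕ) : ℝ) ^ 3 := by
    calc _ = ∑ y, t ^ 2 * ((#(downSet G y) : ℝ) - (2 + t)) := by
          rw [← mul_sum, sum_sub_distrib, sum_const, nsmul_eq_mul]; simp
      _ ≤ _ := sum_le_sum fun y _ => hpt y
  have hedge : (G.edgeSet.ncard : ℝ) ≤ ∑ y, (#(downSet G y) : ℝ) := by
    exact_mod_cast ncard_edgeSet_le_sum_card_downSet G
  have hmain : ∑ y, (#(downSet G y) : ℝ) - 2 ^ n * (2 + t) ≤ 2 ^ n * (C * t) := by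
    refine le_of_mul_le_mul_left ?_ (show 0 < t ^ 2 by positivity)
    calc _ ≤ _ := hlower.trans hupper
      _ = _ := by ring
  have h2n : (0 : ℝ) ≤ 2 ^ n := by positivity
  have : (2 : ℝ) ^ n * (2 + t) ≤ 2 ^ n * (3 * t) := by gcongr; linarith
  calc _ ≤ 2 ^ n * (C * t) + 2 ^ n * (3 * t) := by linarith
    _ = _ := by ring

/-- `ex(Q_n, C_{2l}) = O(n^e 2^n)` for odd `l ≥ 7` and every exponent `e ≥ 5/6`. -/
theorem cubeExtremalNumber_cycleGraph_isBigO {l : ℕ} (hl : Odd l) (h7 : 7 ≤ l) {e : ℝ}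
    (he : (5 : ℝ) / 6 ≤ e) :
    (fun n : ℕ => (cubeExtremalNumber n (SimpleGraph.cycleGraph (2 * l)) : ℝ)) =O[atTop]
      (fun n : ℕ => (n : ℝ) ^ e * (2 : ℝ) ^ n) := by
  obtain ⟨j, rfl⟩ := hl
  -- Now `l = 2 * k + 3`, and `l ≥ 7` says `k ≥ 2`, so that the rim of length `2 * k` is a genuine
  -- cycle.
  obtain ⟨k, rfl⟩ : ∃ k, j = k + 1 := ⟨j - 1, by omega⟩
  refine IsBigO.of_bound (((k : ℝ) ^ 2 + 1) + 2 * (2 * k + 3) + 3) ?_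
  filter_upwards [eventually_ge_atTop 1] with n hn
  have hn' : (1 : ℝ) ≤ n := by exact_mod_cast hn
  rw [show 2 * (k + 1) + 1 = 2 * k + 3 by ring, Real.norm_of_nonneg (Nat.cast_nonneg _),
    Real.norm_of_nonneg (by positivity)]
  have : Nonempty (Fin (2 * (2 * k + 3))) := ⟨⟨0, by omega⟩⟩
  obtain ⟨G, hG, hcard⟩ :=
    (cubeExtremalNumber_isGreatest n (SimpleGraph.cycleGraph (2 * (2 * k + 3)))).1
  rw [← hcard]
  refine (ncard_edgeSet_le hn G (by omega) hG).trans ?_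
  gcongr

theorem theorem1 :
    (∀ l : ℕ, Odd l → 7 ≤ l →
      (fun n : ℕ => (cubeExtremalNumber n (SimpleGraph.cycleGraph (2 * l)) : ℝ)) =O[atTop]
        (fun n : ℕ => (n : ℝ) ^ ((5 : ℝ) / 6 + 1 / (3 * ((l : ℝ) - 3))) * (2 : ℝ) ^ n)) ∧
    (∀ k : ℕ, 3 ≤ k →
      (fun n : ℕ => (cubeExtremalNumber n (SimpleGraph.cycleGraph (4 * k + 2)) : ℝ)) =O[atTop]
        (fun n : ℕ => (n : ℝ) ^ ((5 : ℝ) / 6 + 1 / (3 * (2 * (k : ℝ) - 2))) * (2 : ℝ) ^ n)) := by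
  refine ⟨fun l hl h7 => cubeExtremalNumber_cycleGraph_isBigO hl h7 ?_, fun k hk => ?_⟩
  · have : (7 : ℝ) ≤ l := by exact_mod_cast h7
    exact le_add_of_nonneg_right (one_div_nonneg.2 (by linarith))
  · have : (3 : ℝ) ≤ k := by exact_mod_cast hk
    rw [show 4 * k + 2 = 2 * (2 * k + 1) by ring]
    exact cubeExtremalNumber_cycleGraph_isBigO ⟨k, rfl⟩ (by omega)
      (le_add_of_nonneg_right (one_div_nonneg.2 (by linarith)))
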